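/- For $n \ge 1$ let $\mathcal{H}_n$ denote the $n$-dimensional complex Hilbert space $\mathbb{C}^n$. A quantum Latin square of order $n$ over an $n$-dimensional complex Hilbert space $\mathcal{H}$ is an $n \times n$ array of unit vectors of $\mathcal{H}$ such that every row and every column is an orthonormal basis of $\mathcal{H}$. Two unit vectors $u, v \in \mathcal{H}$ are identified if $u = e^{i\theta} v$ for some real number $\theta$, and are called distinct otherwise; the cardinality of a quantum Latin square is the number of distinct vectors in the array. Theorem. For every integer $m \ge 2$ and every integer $c$ with $4m \le c \le 16m^2$ and $c \ne 4m+1$, there is a quantum Latin square of order $4m$ over $\mathcal{H}_m \otimes \mathcal{H}_2^{\otimes 2}$ with cardinality $c$. -/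

import Mathlib

open scoped TensorProduct

/-- The `n`-dimensional complex Hilbert space with its computational basis. -/
abbrev HilbertSp (n : ℕ) : Type := EuclideanSpace ℂ (Fin n)

section QuantumLatinSquare

variable {E : Type*} [NormedAddCommGroup E] [InnerProductSpace ℂ E]

/-- A finite family of vectors is an orthonormal basis of `E`: it is orthonormal and spans `E`. -/
def IsOrthonormalBasis {n : ℕ} (v : Fin n → E) : Prop :=
  Orthonormal ℂ v ∧ Submodule.span ℂ (Set.range v) = ⊤

/-- A quantum Latin square of order `n` over `E`: an `n × n` array of vectors of `E` in which every
row and every column is an orthonormal basis of `E` (so the entries are unit vectors and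
`E` has dimension `n`). -/
structure IsQLS {n : ℕ} (A : Fin n → Fin n → E) : Prop where
  row : ∀ i : Fin n, IsOrthonormalBasis (fun j : Fin n => A i j)
  col : ∀ j : Fin n, IsOrthonormalBasis (fun i : Fin n => A i j)

/-- Two vectors are identified if they differ by a global phase `exp (i θ)` with `θ` real. -/
def PhaseEq (u v : E) : Prop :=
  ∃ θ : ℝ, u = Complex.exp (Complex.I * (θ : ℂ)) • v

theorem phaseEq_equivalence : Equivalence (PhaseEq (E := E)) where
  refl u := ⟨0, by simp⟩
  symm := by
    rintro u v ⟨θ, rfl⟩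
    exact ⟨-θ, by rw [smul_smul, ← Complex.exp_add]; simp⟩
  trans := by
    rintro u v w ⟨θ, rfl⟩ ⟨η, rfl⟩
    exact ⟨θ + η, by rw [smul_smul, ← Complex.exp_add]; push_cast; rw [mul_add]⟩

variable (E) in
/-- Equality up to a global phase, as a setoid. -/
def phaseSetoid : Setoid E := ⟨PhaseEq, phaseEq_equivalence⟩

/-- The cardinality of an array: the number of its distinct entries, where entries that differ
by a global phase are identified. -/
noncomputable def qlsCardinality {n : ℕ} (A : Fin n → Fin n → E) : ℕ :=
  (Set.range fun p : Fin n × Fin n => Quotient.mk (phaseSetoid E) (A p.1 p.2)).ncard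

end QuantumLatinSquare

/-! ### Unitaries that move only one direction -/

section PhaseShift

variable {E : Type*} [NormedAddCommGroup E] [InnerProductSpace ℂ E]

/-! Split the array into `m × m` blocks and give block `(i, j)` the copy of ℂ⁴ labelled `i + j`, so
that distinct blocks in a row or column lie in orthogonal copies. Any 4 × 4 orthonormal squares may
fill the blocks. Classes in different copies never coincide, so the cardinality is a sum over labels
`k` of the classes in the `m` squares labelled `k`.

For each label, start from a square with `f` = 4, 8 or 16 classes. Each further square is a reused
square, or a product square shifted by the unitary that multiplies a chosen `x` by a phase `z`
(`exists_square_ncard_union`). Entries orthogonal to `x` stay put and are already present; for all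
but finitely many `z` the others become new. Hence the square adds exactly as many classes as it has
distinct entries not orthogonal to `x`. Choosing `x` realizes the available increments
(`exists_shiftAdds`, `exists_shiftAdds_one_one`), and `exists_increments` writes `c` as `m * f` plus
`m * (m - 1)` increments. -/

theorem phaseEq_map_iff {F : Type*} [NormedAddCommGroup F] [InnerProductSpace ℂ F]
    (U : E →ₗᵢ[ℂ] F) {u v : E} : PhaseEq (U u) (U v) ↔ PhaseEq u v := by
  simp only [PhaseEq, ← map_smul, U.injective.eq_iff]

/-- The linear map multiplying `x` by `z` and fixing the orthogonal complement of `x`. -/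
noncomputable def phaseShift (x : E) (z : ℂ) : E →ₗ[ℂ] E :=
  LinearMap.id + ((z - 1) / inner ℂ x x) • (innerₛₗ ℂ x).smulRight x

theorem phaseShift_apply (x : E) (z : ℂ) (u : E) :
    phaseShift x z u = u + ((z - 1) * (inner ℂ x u / inner ℂ x x)) • x := by
  simp [phaseShift, smul_smul, div_mul_eq_mul_div, mul_div_assoc]

theorem inner_phaseShift {x : E} (hx : x ≠ 0) {z : ℂ} (hz : ‖z‖ = 1) (u v : E) :
    inner ℂ (phaseShift x z u) (phaseShift x z v) = inner ℂ u v := by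
  have hN : inner ℂ x x ≠ 0 := inner_self_ne_zero.2 hx
  have hzz : (starRingEnd ℂ) z * z = 1 := by
    rw [← Complex.normSq_eq_conj_mul_self, Complex.normSq_eq_norm_sq, hz]; simp
  rw [phaseShift_apply, phaseShift_apply]
  simp only [inner_add_left, inner_add_right, inner_smul_left, inner_smul_right, map_mul, map_div₀,
    inner_conj_symm, map_sub, map_one]
  field_simp
  linear_combination (inner ℂ u x * inner ℂ x v) * hzz

/-- A unitary fixing `x`-perp that moves finitely many vectors away from finitely many classes. -/
theorem exists_isometry_avoiding {x : E} (hx : x ≠ 0) {M : Set E} (hM : M.Finite)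
    {T : Set (Quotient (phaseSetoid E))} (hT : T.Finite)
    (hMx : ∀ u ∈ M, inner ℂ x u ≠ 0 ∧ ∀ c : ℂ, u ≠ c • x) :
    ∃ U : E →ₗᵢ[ℂ] E, (∀ u, inner ℂ x u = 0 → U u = u) ∧
      ∀ u ∈ M, Quotient.mk (phaseSetoid E) (U u) ∉ T := by
  -- As `u` is not parallel to `x`, a phase relating two shifts must be 1; as `u` is not orthogonal
  -- to `x`, the shift then determines `z`. So each class in `T` excludes at most one `z` per `u`,
  -- while the unit circle is infinite.
  have hinj : ∀ u ∈ M, Function.Injective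
      fun z : ℂ => Quotient.mk (phaseSetoid E) (phaseShift x z u) := by
    intro u hu z z' h
    obtain ⟨hux, hpar⟩ := hMx u hu
    obtain ⟨θ, hθ⟩ : PhaseEq (phaseShift x z u) (phaseShift x z' u) := Quotient.exact h
    generalize Complex.exp (Complex.I * (θ : ℂ)) = w at hθ
    rw [phaseShift_apply, phaseShift_apply] at hθ
    have hq : inner ℂ x u / inner ℂ x x ≠ 0 := div_ne_zero hux (inner_self_ne_zero.2 hx)
    set q := inner ℂ x u / inner ℂ x x
    have h1 : (1 - w) • u = (w * ((z' - 1) * q) - (z - 1) * q) • x := by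
      rw [smul_add, smul_smul] at hθ
      rw [sub_smul, sub_smul, one_smul, sub_eq_sub_iff_add_eq_add, hθ, add_comm]
    have hw : w = 1 := by
      by_contra hw
      have hw' : (1 - w) ≠ 0 := sub_ne_zero.2 (Ne.symm hw)
      refine hpar ((1 - w)⁻¹ * (w * ((z' - 1) * q) - (z - 1) * q)) ?_
      rw [← smul_smul, ← h1, smul_smul, inv_mul_cancel₀ hw', one_smul]
    subst hw
    rw [sub_self, zero_smul, eq_comm, smul_eq_zero, or_iff_left hx] at h1
    have h2 : (z' - z) * q = 0 := by linear_combination h1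
    rcases mul_eq_zero.1 h2 with h3 | h3
    · exact (sub_eq_zero.1 h3).symm
    · exact absurd h3 hq
  have hbad : (⋃ u ∈ M,
      (fun z : ℂ => Quotient.mk (phaseSetoid E) (phaseShift x z u)) ⁻¹' T).Finite :=
    hM.biUnion fun u hu => hT.preimage (hinj u hu).injOn
  have hcirc : (Metric.sphere (0 : ℂ) 1).Infinite := by
    refine (isPreconnected_sphere (by simp [Complex.rank_real_complex]) 0 1).infinite_of_nontrivial
      ⟨1, by simp, -1, by simp, ?_⟩
    norm_num
  obtain ⟨z, hz, hzb⟩ := hcirc.exists_notMem_finite hbad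
  rw [mem_sphere_zero_iff_norm] at hz
  refine ⟨(phaseShift x z).isometryOfInner (inner_phaseShift hx hz), fun u hu => ?_,
    fun u hu hmem => hzb (Set.mem_biUnion hu hmem)⟩
  rw [LinearMap.coe_isometryOfInner, phaseShift_apply, hu]
  simp

end PhaseShift

/-! ### Orthonormal squares and the classes they add -/

section Squares

variable {E : Type*} [NormedAddCommGroup E] [InnerProductSpace ℂ E] {n : ℕ}

/-- A square array whose rows and columns are orthonormal. -/
def IsOrthonormalSquare (B : Fin n → Fin n → E) : Prop :=
  (∀ i, Orthonormal ℂ (B i)) ∧ ∀ j, Orthonormal ℂ fun i => B i j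

/-- The entries of an array up to phase. -/
def phaseClasses (B : Fin n → Fin n → E) : Set (Quotient (phaseSetoid E)) :=
  Set.range fun p : Fin n × Fin n => Quotient.mk (phaseSetoid E) (B p.1 p.2)

theorem phaseClasses_finite (B : Fin n → Fin n → E) : (phaseClasses B).Finite :=
  Set.finite_range _

theorem IsOrthonormalSquare.map {B : Fin n → Fin n → E} (hB : IsOrthonormalSquare B)
    (U : E →ₗᵢ[ℂ] E) : IsOrthonormalSquare fun i j => U (B i j) :=
  ⟨fun i => (hB.1 i).comp_linearIsometry U, fun j => (hB.2 j).comp_linearIsometry U⟩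

/-- Shifting the phase along `x` turns `B` into a square whose entries orthogonal to `x` are
unchanged and whose other entries are new. -/
theorem exists_square_ncard_union {B : Fin n → Fin n → E} (hB : IsOrthonormalSquare B)
    {T : Set (Quotient (phaseSetoid E))} (hT : T.Finite) {x : E} (hx : x ≠ 0)
    (hfix : ∀ i j, inner ℂ x (B i j) = 0 → Quotient.mk (phaseSetoid E) (B i j) ∈ T)
    (hpar : ∀ i j, ∀ c : ℂ, B i j ≠ c • x) :
    ∃ B' : Fin n → Fin n → E, IsOrthonormalSquare B' ∧
      (T ∪ phaseClasses B').ncard = T.ncard +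
        (Quotient.mk (phaseSetoid E) '' {u | inner ℂ x u ≠ 0 ∧ ∃ i j, B i j = u}).ncard := by
  set M : Set E := {u | inner ℂ x u ≠ 0 ∧ ∃ i j, B i j = u}
  have hM : M.Finite := by
    refine (Set.finite_range fun p : Fin n × Fin n => B p.1 p.2).subset ?_
    rintro _ ⟨-, i, j, rfl⟩
    exact ⟨(i, j), rfl⟩
  obtain ⟨U, hU, hUT⟩ := exists_isometry_avoiding hx hM hT (by
    rintro _ ⟨hu, i, j, rfl⟩
    exact ⟨hu, hpar i j⟩)
  refine ⟨_, hB.map U, ?_⟩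
  let g : Quotient (phaseSetoid E) → Quotient (phaseSetoid E) :=
    Quotient.map U fun u v h => (phaseEq_map_iff U).2 h
  have hg : Function.Injective g := by
    rintro ⟨u⟩ ⟨v⟩ h
    exact Quotient.sound ((phaseEq_map_iff U).1 (Quotient.exact h))
  have hunion : T ∪ phaseClasses (fun i j => U (B i j)) =
      T ∪ g '' (Quotient.mk (phaseSetoid E) '' M) := by
    ext t
    constructor
    · rintro (h | ⟨⟨i, j⟩, rfl⟩)
      · exact Or.inl h
      · by_cases h0 : inner ℂ x (B i j) = 0
        · left
          simpa only [hU _ h0] using hfix i j h0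
        · exact Or.inr ⟨_, ⟨B i j, ⟨h0, i, j, rfl⟩, rfl⟩, rfl⟩
    · rintro (h | ⟨_, ⟨_, ⟨-, i, j, rfl⟩, rfl⟩, rfl⟩)
      · exact Or.inl h
      · exact Or.inr ⟨(i, j), rfl⟩
  rw [hunion, Set.ncard_union_eq ?_ hT ((hM.image _).image _), Set.ncard_image_of_injective _ hg]
  rw [Set.disjoint_right]
  rintro _ ⟨_, ⟨u, hu, rfl⟩, rfl⟩
  exact hUT u hu

end Squares

/-! ### Arithmetic of the increments -/

/-- The numbers of new classes that a further square can contribute. -/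
def increments : Finset ℕ := {0, 2, 3, 4, 6, 7, 8, 14, 15, 16}

/-- The numbers of new classes that a further square can contribute to a square with 16 classes. -/
def largeIncrements : Finset ℕ := increments ∪ {12, 13}

/-- Two increments reach every total up to 24 except 1, but not 25; hence the margin of 8. Each
extra summand is 0 or 16. -/
theorem exists_sum_increments {n : ℕ} (hn : 2 ≤ n) {s : ℕ} (h1 : s ≠ 1) (hs : s + 8 ≤ 16 * n) :
    ∃ d : Fin n → ℕ, (∀ i, d i ∈ increments) ∧ ∑ i, d i = s := by
  induction n, hn using Nat.le_induction generalizing s with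
  | base =>
    have key : ∀ s ≤ 24, s ≠ 1 → ∃ a ∈ increments, ∃ b ∈ increments, a + b = s := by decide
    obtain ⟨a, ha, b, hb, h⟩ := key s (by omega) h1
    exact ⟨![a, b], by simp [Fin.forall_fin_two, ha, hb], by simpa using h⟩
  | succ n hn ih =>
    obtain ⟨a, t, ha, ht1, ht, rfl⟩ :
        ∃ a t, a ∈ increments ∧ t ≠ 1 ∧ t + 8 ≤ 16 * n ∧ a + t = s := by
      by_cases h : s + 8 ≤ 16 * n
      · exact ⟨0, s, by decide, h1, h, by omega⟩
      · exact ⟨16, s - 16, by decide, by omega, by omega, by omega⟩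
    obtain ⟨d, hd, rfl⟩ := ih ht1 ht
    exact ⟨Fin.cons a d, Fin.cases (by simpa using ha) (by simpa using hd), by
      simp [Fin.sum_univ_succ]⟩

theorem exists_sum_largeIncrements {n : ℕ} (hn : 2 ≤ n) {s : ℕ} (h1 : s ≠ 1) (hs : s ≤ 16 * n) :
    ∃ d : Fin n → ℕ, (∀ i, d i ∈ largeIncrements) ∧ ∑ i, d i = s := by
  induction n, hn using Nat.le_induction generalizing s with
  | base =>
    have key : ∀ s ≤ 32, s ≠ 1 → ∃ a ∈ largeIncrements, ∃ b ∈ largeIncrements, a + b = s := by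
      decide
    obtain ⟨a, ha, b, hb, h⟩ := key s (by omega) h1
    exact ⟨![a, b], by simp [Fin.forall_fin_two, ha, hb], by simpa using h⟩
  | succ n hn ih =>
    obtain ⟨a, t, ha, ht1, ht, rfl⟩ :
        ∃ a t, a ∈ largeIncrements ∧ t ≠ 1 ∧ t ≤ 16 * n ∧ a + t = s := by
      by_cases h : s ≤ 16 * n
      · exact ⟨0, s, by decide, h1, h, by omega⟩
      · exact ⟨16, s - 16, by decide, by omega, by omega, by omega⟩
    obtain ⟨d, hd, rfl⟩ := ih ht1 ht
    exact ⟨Fin.cons a d, Fin.cases (by simpa using ha) (by simpa using hd), by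
      simp [Fin.sum_univ_succ]⟩

/-- The number of classes in a square and the increments available on top of it. -/
inductive HasIncrements : ℕ → Finset ℕ → Prop
  | four : HasIncrements 4 increments
  | eight : HasIncrements 8 increments
  | sixteen : HasIncrements 16 largeIncrements

theorem exists_increments {m c : ℕ} (hm : 2 ≤ m) (hc_lower : 4 * m ≤ c)
    (hc_upper : c ≤ 16 * m ^ 2) (hc_ne : c ≠ 4 * m + 1) :
    ∃ (f : ℕ) (D : Finset ℕ) (d : Fin m → Fin (m - 1) → ℕ), HasIncrements f D ∧
      (∀ k l, d k l ∈ D) ∧ ∑ k, (f + ∑ l, d k l) = c := by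
  obtain ⟨f, D, d, hf, hd, hc⟩ : ∃ (f : ℕ) (D : Finset ℕ) (d : Fin (m * (m - 1)) → ℕ),
      HasIncrements f D ∧ (∀ k, d k ∈ D) ∧ m * f + ∑ k, d k = c := by
    obtain ⟨r, rfl⟩ : ∃ r, m = r + 2 := ⟨m - 2, by omega⟩
    have hn : 2 ≤ (r + 2) * (r + 2 - 1) := by
      rw [show r + 2 - 1 = r + 1 by omega]; nlinarith
    have hN : (r + 2) * (r + 2 - 1) = r ^ 2 + 3 * r + 2 := by
      rw [show r + 2 - 1 = r + 1 by omega]; ring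
    have hr : (r + 2) ^ 2 = r ^ 2 + 4 * r + 4 := by ring
    have hrr : r = 0 ∨ 1 ≤ r ^ 2 := by
      rcases Nat.eq_zero_or_pos r with h | h
      · exact Or.inl h
      · exact Or.inr (Nat.one_le_pow _ _ h)
    by_cases h4 : c - 4 * (r + 2) + 8 ≤ 16 * ((r + 2) * (r + 2 - 1))
    · obtain ⟨d, hd, hs⟩ := exists_sum_increments hn (s := c - 4 * (r + 2)) (by omega) h4
      exact ⟨4, _, d, .four, hd, by omega⟩
    -- Starting from 16 classes leaves remainder `c - 16 * m`, which equals 1 here only for `m = 2`,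
    -- `c = 33`; there 8 classes leave 17.
    by_cases h33 : r = 0 ∧ c = 33
    · obtain ⟨d, hd, hs⟩ := exists_sum_increments hn (s := 17) (by omega) (by omega)
      exact ⟨8, _, d, .eight, hd, by omega⟩
    · obtain ⟨d, hd, hs⟩ := exists_sum_largeIncrements hn (s := c - 16 * (r + 2))
        (by omega) (by omega)
      exact ⟨16, _, d, .sixteen, hd, by omega⟩
  refine ⟨f, D, fun k l => d (finProdFinEquiv (k, l)), hf, fun k l => hd _, ?_⟩
  rw [Finset.sum_add_distrib, ← Fintype.sum_prod_type', Finset.sum_const, Finset.card_univ,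
    Fintype.card_fin, smul_eq_mul, ← hc]
  congr 1
  exact Equiv.sum_comp finProdFinEquiv d

/-! ### Explicit squares from the 3-4-5 triangle -/

section IntegerSquares

/-- Two orthogonal bases of `ℤ²` of vectors of length 5. -/
def planeBasis : Fin 2 → Fin 2 → Fin 2 → ℤ :=
  ![![![5, 0], ![0, 5]], ![![3, 4], ![-4, 3]]]

/-- The two binary digits of an index below 4. -/
def digits : Fin 4 → Fin 2 × Fin 2 := ![(0, 0), (0, 1), (1, 0), (1, 1)]

/-- A square of tensor products of vectors of `planeBasis`, of length 25. The second basis occurs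
in the first factor if `r = 1`, and in the second factor if `s = 1`. -/
def productSquare (r s : Fin 2) (i j k : Fin 4) : ℤ :=
  planeBasis (r * (digits j).2) ((digits i).1 + (digits j).1) (digits k).1 *
    planeBasis (s * (digits i).1) ((digits i).2 + (digits j).2) (digits k).2

/-- The distinct entries of `productSquare r s` that are not orthogonal to `x`. -/
def nonorthogonalEntries (r s : Fin 2) (x : Fin 4 → ℤ) : Finset (Fin 4 → ℤ) :=
  (Finset.univ.image fun p : Fin 4 × Fin 4 => productSquare r s p.1 p.2).filter fun u => x ⬝ᵥ u ≠ 0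

/-- A vector of `ℤ⁴` of length 25, normalized. -/
noncomputable def normalizedVec (u : Fin 4 → ℤ) : HilbertSp 4 :=
  WithLp.toLp 2 fun k => (u k : ℂ) / 25

theorem inner_normalizedVec (u v : Fin 4 → ℤ) :
    inner ℂ (normalizedVec u) (normalizedVec v) = ((u ⬝ᵥ v : ℤ) : ℂ) / 625 := by
  simp only [normalizedVec, PiLp.inner_apply, RCLike.inner_apply, map_div₀, map_intCast, dotProduct,
    Int.cast_sum, Int.cast_mul, Finset.sum_div, map_ofNat]
  refine Finset.sum_congr rfl fun k _ => ?_
  ring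

theorem mul_eq_mul_of_normalizedVec_eq_smul {u v : Fin 4 → ℤ} {c : ℂ}
    (h : normalizedVec u = c • normalizedVec v) (i j : Fin 4) : u i * v j = u j * v i := by
  have key (k : Fin 4) : (u k : ℂ) = c * v k := by
    have := congrArg (fun w : HilbertSp 4 => w k * 25) h
    simp [normalizedVec] at this
    linear_combination this
  have : (u i : ℂ) * v j = u j * v i := by rw [key i, key j]; ring
  exact_mod_cast this

theorem orthonormal_normalizedVec {w : Fin 4 → Fin 4 → ℤ}
    (h : ∀ i j, w i ⬝ᵥ w j = if i = j then 625 else 0) :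
    Orthonormal ℂ fun i => normalizedVec (w i) := by
  rw [orthonormal_iff_ite]
  intro i j
  rw [inner_normalizedVec, h]
  split_ifs <;> simp

/-- The unit square obtained from `productSquare r s`. -/
noncomputable def unitSquare (r s : Fin 2) (i j : Fin 4) : HilbertSp 4 :=
  normalizedVec (productSquare r s i j)

/-- Along a row the second-factor basis is constant: columns with different second digits are
orthogonal in that factor, and those with equal second digits share a first-factor basis and differ
there. Columns are symmetric, with the factors exchanged. -/
theorem isOrthonormalSquare_unitSquare (r s : Fin 2) : IsOrthonormalSquare (unitSquare r s) := by
  constructor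
  · intro i
    exact orthonormal_normalizedVec (by revert r s i; decide +kernel)
  · intro j
    exact orthonormal_normalizedVec (w := fun i => productSquare r s i j)
      (by revert r s j; decide +kernel)

/-- Makes counting classes up to phase the same as counting integer vectors. -/
theorem productSquare_eq_or_not_parallel : ∀ r s i j i' j',
    productSquare r s i j = productSquare r s i' j' ∨
    ∃ k l, productSquare r s i j k * productSquare r s i' j' l ≠
      productSquare r s i j l * productSquare r s i' j' k := by
  decide +kernel

theorem ncard_classes_nonorthogonalEntries (r s : Fin 2) (x : Fin 4 → ℤ) :
    (Quotient.mk (phaseSetoid (HilbertSp 4)) '' {u | inner ℂ (normalizedVec x) u ≠ 0 ∧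
      ∃ i j, unitSquare r s i j = u}).ncard = (nonorthogonalEntries r s x).card := by
  have himage : {u | inner ℂ (normalizedVec x) u ≠ 0 ∧ ∃ i j, unitSquare r s i j = u} =
      normalizedVec '' (nonorthogonalEntries r s x : Set (Fin 4 → ℤ)) := by
    ext u
    simp only [nonorthogonalEntries, Finset.coe_filter, Finset.mem_image, Finset.mem_univ, true_and,
      Set.mem_ofPred_eq, Set.mem_image, Prod.exists]
    constructor
    · rintro ⟨h, i, j, rfl⟩
      refine ⟨_, ⟨⟨i, j, rfl⟩, fun h0 => h ?_⟩, rfl⟩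
      rw [unitSquare, inner_normalizedVec, h0]; simp
    · rintro ⟨_, ⟨⟨i, j, rfl⟩, h0⟩, rfl⟩
      refine ⟨?_, i, j, rfl⟩
      rw [inner_normalizedVec]
      exact div_ne_zero (Int.cast_ne_zero.2 h0) (by norm_num)
  rw [himage, Set.image_image, Set.InjOn.ncard_image, Set.ncard_coe_finset]
  intro u hu v hv huv
  simp only [nonorthogonalEntries, Finset.coe_filter, Finset.mem_image, Finset.mem_univ, true_and,
    Set.mem_ofPred_eq, Prod.exists] at hu hv
  obtain ⟨⟨i, j, rfl⟩, -⟩ := hu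
  obtain ⟨⟨i', j', rfl⟩, -⟩ := hv
  obtain ⟨θ, hθ⟩ : PhaseEq _ _ := Quotient.exact huv
  rcases productSquare_eq_or_not_parallel r s i j i' j' with h | ⟨k, l, h⟩
  · exact h
  · exact absurd (mul_eq_mul_of_normalizedVec_eq_smul hθ k l) h

/-- Shifting the phase of `productSquare r s` along `x` fixes only entries of
`productSquare r₀ s₀` and moves exactly `d` entries. -/
def ShiftAdds (r₀ s₀ : Fin 2) (d : ℕ) (r s : Fin 2) (x : Fin 4 → ℤ) : Prop :=
  (∀ i j, x ⬝ᵥ productSquare r s i j = 0 →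
    ∃ i' j', productSquare r₀ s₀ i' j' = productSquare r s i j) ∧
  (∀ i j, ∃ k l, productSquare r s i j k * x l ≠ productSquare r s i j l * x k) ∧
  (nonorthogonalEntries r s x).card = d

instance (r₀ s₀ : Fin 2) (d : ℕ) (r s : Fin 2) (x : Fin 4 → ℤ) :
    Decidable (ShiftAdds r₀ s₀ d r s x) := by
  unfold ShiftAdds; infer_instance

/-- Works over every `r₀`, `s₀` because each `x` below is orthogonal only to entries along the
computational basis, which occur in all the product squares. -/
theorem exists_shiftAdds (r₀ s₀ : Fin 2) {d : ℕ} (hd : d ∈ increments) (h0 : d ≠ 0) :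
    ∃ r s x, ShiftAdds r₀ s₀ d r s x := by
  simp only [increments, Finset.mem_insert, Finset.mem_singleton] at hd
  obtain rfl | rfl | rfl | rfl | rfl | rfl | rfl | rfl | rfl | rfl := hd
  · exact absurd rfl h0
  · exact ⟨0, 0, ![1, 1, 0, 0], by revert r₀ s₀; decide +kernel⟩
  · exact ⟨0, 0, ![1, 1, 1, 0], by revert r₀ s₀; decide +kernel⟩
  · exact ⟨0, 0, ![1, 1, 1, 1], by revert r₀ s₀; decide +kernel⟩
  · exact ⟨0, 1, ![1, 0, 1, 0], by revert r₀ s₀; decide +kernel⟩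
  · exact ⟨0, 1, ![1, 1, 1, 0], by revert r₀ s₀; decide +kernel⟩
  · exact ⟨0, 1, ![1, 1, 1, 1], by revert r₀ s₀; decide +kernel⟩
  · exact ⟨1, 1, ![-1, 0, 0, 1], by revert r₀ s₀; decide +kernel⟩
  · exact ⟨1, 1, ![1, 1, 1, 0], by revert r₀ s₀; decide +kernel⟩
  · exact ⟨1, 1, ![1, 1, 1, 1], by revert r₀ s₀; decide +kernel⟩

/-- For 12 and 13 the fixed entries include vectors outside the computational basis, all of them
present in the 16-class square. -/
theorem exists_shiftAdds_one_one {d : ℕ} (hd : d ∈ largeIncrements) (h0 : d ≠ 0) :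
    ∃ r s x, ShiftAdds 1 1 d r s x := by
  simp only [largeIncrements, Finset.mem_union, Finset.mem_insert, Finset.mem_singleton] at hd
  obtain hd | rfl | rfl := hd
  · exact exists_shiftAdds 1 1 hd h0
  · exact ⟨1, 1, ![1, 1, 0, 0], by decide +kernel⟩
  · exact ⟨1, 1, ![-4, 0, 3, 4], by decide +kernel⟩

theorem exists_square_add {r₀ s₀ r s : Fin 2} {d : ℕ} {x : Fin 4 → ℤ}
    (h : ShiftAdds r₀ s₀ d r s x) {T : Set (Quotient (phaseSetoid (HilbertSp 4)))} (hT : T.Finite)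
    (hsub : phaseClasses (unitSquare r₀ s₀) ⊆ T) :
    ∃ B : Fin 4 → Fin 4 → HilbertSp 4, IsOrthonormalSquare B ∧
      (T ∪ phaseClasses B).ncard = T.ncard + d := by
  obtain ⟨hfix, hpar, rfl⟩ := h
  rw [← ncard_classes_nonorthogonalEntries]
  refine exists_square_ncard_union (isOrthonormalSquare_unitSquare r s) hT ?_ ?_ ?_
  · intro hx
    obtain ⟨k, l, h⟩ := hpar 0 0
    have hz : normalizedVec x = (0 : ℂ) • normalizedVec (productSquare r s 0 0) := by simp [hx]
    exact h (by linear_combination -mul_eq_mul_of_normalizedVec_eq_smul hz k l)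
  · intro i j hij
    rw [unitSquare, inner_normalizedVec, div_eq_zero_iff, or_iff_left (by norm_num),
      Int.cast_eq_zero] at hij
    obtain ⟨i', j', h⟩ := hfix i j hij
    exact hsub ⟨(i', j'), by simp only [unitSquare, h]⟩
  · intro i j c hc
    obtain ⟨k, l, h⟩ := hpar i j
    exact h (mul_eq_mul_of_normalizedVec_eq_smul hc k l)

theorem ncard_phaseClasses_unitSquare {f : ℕ} {r s : Fin 2} {x : Fin 4 → ℤ}
    (hx : ∀ i j, x ⬝ᵥ productSquare r s i j ≠ 0) (hf : (nonorthogonalEntries r s x).card = f) :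
    (phaseClasses (unitSquare r s)).ncard = f := by
  subst hf
  rw [← ncard_classes_nonorthogonalEntries]
  refine congrArg Set.ncard (Set.ext fun t => ⟨?_, ?_⟩)
  · rintro ⟨⟨i, j⟩, rfl⟩
    refine ⟨_, ⟨?_, i, j, rfl⟩, rfl⟩
    rw [unitSquare, inner_normalizedVec]
    exact div_ne_zero (Int.cast_ne_zero.2 (hx i j)) (by norm_num)
  · rintro ⟨_, ⟨-, i, j, rfl⟩, rfl⟩
    exact ⟨(i, j), rfl⟩

theorem HasIncrements.exists_square {f : ℕ} {D : Finset ℕ} (h : HasIncrements f D) :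
    ∃ B : Fin 4 → Fin 4 → HilbertSp 4, IsOrthonormalSquare B ∧ (phaseClasses B).ncard = f ∧
      ∀ d ∈ D, ∀ T : Set (Quotient (phaseSetoid (HilbertSp 4))), T.Finite → phaseClasses B ⊆ T →
        ∃ B' : Fin 4 → Fin 4 → HilbertSp 4, IsOrthonormalSquare B' ∧
          (T ∪ phaseClasses B').ncard = T.ncard + d := by
  suffices h : ∃ r s x, (∀ i j, x ⬝ᵥ productSquare r s i j ≠ 0) ∧
      (nonorthogonalEntries r s x).card = f ∧
      ∀ d ∈ D, d ≠ 0 → ∃ r' s' x', ShiftAdds r s d r' s' x' by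
    obtain ⟨r, s, x, hx, hf, hD⟩ := h
    refine ⟨unitSquare r s, isOrthonormalSquare_unitSquare r s,
      ncard_phaseClasses_unitSquare hx hf, fun d hd T hT hsub => ?_⟩
    rcases eq_or_ne d 0 with rfl | h0
    · exact ⟨_, isOrthonormalSquare_unitSquare r s, by
        rw [Set.union_eq_self_of_subset_right hsub, add_zero]⟩
    · obtain ⟨r', s', x', h⟩ := hD d hd h0
      exact exists_square_add h hT hsub
  cases h with
  | four => exact ⟨0, 0, ![1, 1, 1, 1], by decide +kernel, by decide +kernel,
      fun d hd h0 => exists_shiftAdds 0 0 hd h0⟩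
  | eight => exact ⟨0, 1, ![1, 1, 1, 1], by decide +kernel, by decide +kernel,
      fun d hd h0 => exists_shiftAdds 0 1 hd h0⟩
  | sixteen => exact ⟨1, 1, ![1, 1, 1, 1], by decide +kernel, by decide +kernel,
      fun d hd h0 => exists_shiftAdds_one_one hd h0⟩

/-- A sequence of squares with a prescribed number of classes in total. -/
theorem HasIncrements.exists_squares {f : ℕ} {D : Finset ℕ} (h : HasIncrements f D) {n : ℕ}
    (d : Fin n → ℕ) (hd : ∀ l, d l ∈ D) :
    ∃ C : Fin (n + 1) → Fin 4 → Fin 4 → HilbertSp 4, (∀ l, IsOrthonormalSquare (C l)) ∧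
      (⋃ l, phaseClasses (C l)).ncard = f + ∑ l, d l := by
  obtain ⟨B, hB, hf, hadd⟩ := h.exists_square
  -- The induction also carries the inclusion of the classes of `B`, since increments are available
  -- only above these.
  suffices h : ∃ C : Fin (n + 1) → Fin 4 → Fin 4 → HilbertSp 4, (∀ l, IsOrthonormalSquare (C l)) ∧
      phaseClasses B ⊆ (⋃ l, phaseClasses (C l)) ∧
      (⋃ l, phaseClasses (C l)).ncard = f + ∑ l, d l by
    obtain ⟨C, h1, -, h2⟩ := h
    exact ⟨C, h1, h2⟩
  induction n with
  | zero => exact ⟨fun _ => B, fun _ => hB, by rw [Set.iUnion_const], by simp [Set.iUnion_const, hf]⟩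
  | succ n ih =>
    obtain ⟨C, hC, hsub, hcard⟩ := ih (fun l => d l.succ) fun l => hd _
    obtain ⟨B', hB', hcard'⟩ := hadd (d 0) (hd 0) _
      (Set.finite_iUnion fun l => phaseClasses_finite (C l)) hsub
    have hunion : (⋃ l, phaseClasses (Fin.cons (α := fun _ => Fin 4 → Fin 4 → HilbertSp 4) B' C l)) =
        (⋃ l, phaseClasses (C l)) ∪ phaseClasses B' := by
      ext t
      simp [Fin.exists_fin_succ, or_comm]
    refine ⟨Fin.cons B' C, Fin.cases hB' hC, ?_, ?_⟩
    · rw [hunion]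
      exact hsub.trans Set.subset_union_left
    · rw [hunion, hcard', hcard, Fin.sum_univ_succ]
      ring

end IntegerSquares

/-! ### Assembling blocks in orthogonal copies -/

section OrthogonalAssembly

variable {V E : Type*} [NormedAddCommGroup V] [InnerProductSpace ℂ V]
  [NormedAddCommGroup E] [InnerProductSpace ℂ E]

theorem Orthonormal.isOrthonormalBasis [FiniteDimensional ℂ E] {n : ℕ} {v : Fin n → E}
    (hv : Orthonormal ℂ v) (hn : Module.finrank ℂ E = n) : IsOrthonormalBasis v :=
  ⟨hv, hv.linearIndependent.span_eq_top_of_card_eq_finrank' (by simp [hn])⟩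

variable {m n : ℕ}

/-- The array whose block at `(i, j)` is the square `C (i + j) i` in the copy of `V` in `E`
labelled `i + j`. -/
def blockArray (J : Fin m → V →ₗᵢ[ℂ] E) (C : Fin m → Fin m → Fin n → Fin n → V)
    (a b : Fin m × Fin n) : E :=
  J (a.1 + b.1) (C (a.1 + b.1) a.1 a.2 b.2)

variable {J : Fin m → V →ₗᵢ[ℂ] E} {C : Fin m → Fin m → Fin n → Fin n → V}

theorem orthonormal_blockArray_row (hJ : ∀ k l, k ≠ l → ∀ u v, inner ℂ (J k u) (J l v) = 0)
    (hC : ∀ k i, IsOrthonormalSquare (C k i)) (a : Fin m × Fin n) :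
    Orthonormal ℂ (blockArray J C a) := by
  rw [orthonormal_iff_ite]
  rintro ⟨j, q⟩ ⟨j', q'⟩
  by_cases h : j = j'
  · subst h
    have := orthonormal_iff_ite.1 ((hC (a.1 + j) a.1).1 a.2) q q'
    simpa [blockArray] using this
  · simp [blockArray, hJ _ _ (mt add_left_cancel h), h]

theorem orthonormal_blockArray_col (hJ : ∀ k l, k ≠ l → ∀ u v, inner ℂ (J k u) (J l v) = 0)
    (hC : ∀ k i, IsOrthonormalSquare (C k i)) (b : Fin m × Fin n) :
    Orthonormal ℂ fun a => blockArray J C a b := by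
  rw [orthonormal_iff_ite]
  rintro ⟨i, p⟩ ⟨i', p'⟩
  by_cases h : i = i'
  · subst h
    have := orthonormal_iff_ite.1 ((hC (i + b.1) i).2 b.2) p p'
    simpa [blockArray] using this
  · simp [blockArray, hJ _ _ (mt add_right_cancel h), h]

/-- Copies with different labels share no class, because a unit vector is not orthogonal to its
phase multiples. -/
theorem ncard_classes_blockArray [NeZero m]
    (hJ : ∀ k l, k ≠ l → ∀ u v, inner ℂ (J k u) (J l v) = 0)
    (hC : ∀ k i, IsOrthonormalSquare (C k i)) :
    (Set.range fun ab : (Fin m × Fin n) × (Fin m × Fin n) =>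
      Quotient.mk (phaseSetoid E) (blockArray J C ab.1 ab.2)).ncard =
      ∑ k, (⋃ i, phaseClasses (C k i)).ncard := by
  let g (k : Fin m) : Quotient (phaseSetoid V) → Quotient (phaseSetoid E) :=
    Quotient.map (J k) fun u v h => (phaseEq_map_iff (J k)).2 h
  have hg (k : Fin m) : Function.Injective (g k) := by
    rintro ⟨u⟩ ⟨v⟩ h
    exact Quotient.sound ((phaseEq_map_iff (J k)).1 (Quotient.exact h))
  have hunion : (Set.range fun ab : (Fin m × Fin n) × (Fin m × Fin n) =>
      Quotient.mk (phaseSetoid E) (blockArray J C ab.1 ab.2)) =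
      ⋃ k, g k '' ⋃ i, phaseClasses (C k i) := by
    ext t
    simp only [Set.mem_iUnion, Set.mem_image]
    constructor
    · rintro ⟨⟨⟨i, p⟩, ⟨j, q⟩⟩, rfl⟩
      exact ⟨i + j, _, ⟨i, (p, q), rfl⟩, rfl⟩
    · rintro ⟨k, _, ⟨i, ⟨p, q⟩, rfl⟩, rfl⟩
      -- In block row `i`, label `k` occurs in block column `k - i`.
      refine ⟨((i, p), (k - i, q)), ?_⟩
      simp only [blockArray, add_sub_cancel]
      rfl
  have hfin (k : Fin m) : (⋃ i, phaseClasses (C k i)).Finite :=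
    Set.finite_iUnion fun i => phaseClasses_finite _
  rw [hunion, Set.ncard_iUnion_of_finite fun k => (hfin k).image _, finsum_eq_sum_of_fintype]
  · exact Finset.sum_congr rfl fun k _ => Set.ncard_image_of_injective _ (hg k)
  · intro k l hkl
    rw [Function.onFun, Set.disjoint_left]
    rintro _ ⟨t, ht, rfl⟩ ⟨t', ht', h⟩
    obtain ⟨i, ⟨p, q⟩, rfl⟩ := Set.mem_iUnion.1 ht
    obtain ⟨i', ⟨p', q'⟩, rfl⟩ := Set.mem_iUnion.1 ht'
    obtain ⟨θ, hθ⟩ : PhaseEq (J l (C l i' p' q')) (J k (C k i p q)) := Quotient.exact h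
    have h0 : inner ℂ (J l (C l i' p' q')) (J l (C l i' p' q')) = 0 := by
      nth_rewrite 2 [hθ]
      rw [inner_smul_right, hJ l k (Ne.symm hkl), mul_zero]
    have h1 := ((hC l i').1 p').1 q'
    rw [inner_self_eq_zero, ← norm_eq_zero, LinearIsometry.norm_map, h1] at h0
    exact one_ne_zero h0

theorem exists_isQLS_of_squares [NeZero m] [FiniteDimensional ℂ E] {N : ℕ}
    (e : Fin N ≃ Fin m × Fin n) (hE : Module.finrank ℂ E = N)
    (hJ : ∀ k l, k ≠ l → ∀ u v, inner ℂ (J k u) (J l v) = 0)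
    (hC : ∀ k i, IsOrthonormalSquare (C k i)) :
    ∃ A : Fin N → Fin N → E, IsQLS A ∧
      qlsCardinality A = ∑ k, (⋃ i, phaseClasses (C k i)).ncard := by
  refine ⟨fun a b => blockArray J C (e a) (e b), ⟨fun a => ?_, fun b => ?_⟩, ?_⟩
  · exact ((orthonormal_blockArray_row hJ hC (e a)).comp e e.injective).isOrthonormalBasis hE
  · exact ((orthonormal_blockArray_col hJ hC (e b)).comp e e.injective).isOrthonormalBasis hE
  · rw [← ncard_classes_blockArray hJ hC, qlsCardinality, ← (e.prodCongr e).surjective.range_comp]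
    rfl

/-- The isometry `v ↦ x ⊗ v` for a unit vector `x`. -/
noncomputable def tensorLeftIsometry {x : E} (hx : ‖x‖ = 1) : V →ₗᵢ[ℂ] E ⊗[ℂ] V :=
  (TensorProduct.mk ℂ E V x).isometryOfInner fun u v => by
    simp [TensorProduct.inner_tmul, inner_self_eq_norm_sq_to_K, hx]

/-- Squares in `V` assemble into a quantum Latin square over `F ⊗ G` if `V` embeds in `G`. -/
theorem exists_isQLS_tensorProduct {F G : Type*} [NormedAddCommGroup F] [InnerProductSpace ℂ F]
    [NormedAddCommGroup G] [InnerProductSpace ℂ G] [FiniteDimensional ℂ F] [FiniteDimensional ℂ G]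
    [NeZero m] {N : ℕ} (e : Fin N ≃ Fin m × Fin n)
    (hN : Module.finrank ℂ F * Module.finrank ℂ G = N) {x : Fin m → F} (hx : Orthonormal ℂ x)
    (Φ : V →ₗᵢ[ℂ] G) (hC : ∀ k i, IsOrthonormalSquare (C k i)) :
    ∃ A : Fin N → Fin N → F ⊗[ℂ] G, IsQLS A ∧
      qlsCardinality A = ∑ k, (⋃ i, phaseClasses (C k i)).ncard := by
  refine exists_isQLS_of_squares (J := fun k => (tensorLeftIsometry (hx.1 k)).comp Φ) e
    (by rw [Module.finrank_tensorProduct, hN]) (fun k l hkl u v => ?_) hC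
  exact (TensorProduct.inner_tmul ..).trans (by rw [hx.2 hkl, zero_mul])

end OrthogonalAssembly

/-! ### The main theorem -/

theorem theorem1 (m : ℕ) (hm : 2 ≤ m) (c : ℕ) (hc_lower : 4 * m ≤ c)
    (hc_upper : c ≤ 16 * m ^ 2) (hc_ne : c ≠ 4 * m + 1) :
    ∃ A : Fin (4 * m) → Fin (4 * m) →
        HilbertSp m ⊗[ℂ] (HilbertSp 2 ⊗[ℂ] HilbertSp 2),
      IsQLS A ∧ qlsCardinality A = c := by
  obtain ⟨f, D, d, hD, hd, rfl⟩ := exists_increments hm hc_lower hc_upper hc_ne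
  obtain ⟨r, rfl⟩ : ∃ r, m = r + 1 := ⟨m - 1, by omega⟩
  choose C hC hcard using fun k => hD.exists_squares (d k) (hd k)
  let Φ : HilbertSp 4 ≃ₗᵢ[ℂ] HilbertSp 2 ⊗[ℂ] HilbertSp 2 :=
    ((stdOrthonormalBasis ℂ _).reindex (finCongr (by simp))).repr.symm
  obtain ⟨A, hA, hAc⟩ := exists_isQLS_tensorProduct (N := 4 * (r + 1))
    ((finCongr (mul_comm _ _)).trans finProdFinEquiv.symm)
    (by simp only [Module.finrank_tensorProduct, finrank_euclideanSpace_fin]; ring)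
    (EuclideanSpace.orthonormal_single (ι := Fin (r + 1))) Φ.toLinearIsometry hC
  exact ⟨A, hA, hAc.trans (Finset.sum_congr rfl fun k _ => hcard k)⟩
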